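/- Let $d\in\mathbb N$, $d\ge 1$, let $\mathbb R^d$ carry the Euclidean norm and Lebesgue measure, and put $B_r=\{x\in\mathbb R^d:|x|<r\}$, $\overline B_r=\{x\in\mathbb R^d:|x|\le r\}$. Let $\phi:B_1\to[0,\infty)$ be a radially decreasing weight with profile $\Phi$, that is, $\phi(x)=\Phi(|x|)$ for $x\in B_1$, where $\Phi:[0,1)\to[0,\infty)$ is nonincreasing and right-continuous with left limits, and $\phi$ is not identically zero on $B_1\setminus\overline B_{1/2}$. Let $1\le p<\infty$ and $0<s_0<1$. Then there is a constant $C>0$, depending only on $p$, $d$, $s_0$ and $\Phi$, such that for all $R\ge 1$, all $s$ with $s_0\le s<1$ and all real-valued $u\in L^p(B_1)$, $$\int_{B_1}|u(x)-u_{B_1}^{\phi}|^p\,\phi(x)\,dx\;\le\; C\,(1-s)\,R^{p(1-s)}\int_{B_1}\int_{B_1}\frac{|u(x)-u(y)|^p}{|x-y|^{d+ps}}\,\chi_{\{|x-y|\le 1/R\}}\,\min(\phi(x),\phi(y))\,dy\,dx,$$ where $u_{B_1}^{\phi}=\dfrac{\int_{B_1}u(x)\phi(x)\,dx}{\int_{B_1}\phi(x)\,dx}$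 and the right-hand side may be $+\infty$. -/

import Mathlib

open MeasureTheory Filter Topology Set

/-- `φ` is a radially decreasing weight on the open unit ball around `x₀`, with profile `Φ`.
Only the values of `φ` on the unit ball and those of `Φ` on `[0, 1)` matter. -/
structure IsRadiallyDecreasingWeight {X : Type*} [PseudoMetricSpace X] (x₀ : X)
    (φ : X → ℝ) (Φ : ℝ → ℝ) : Prop where
  nonneg : ∀ x ∈ Metric.ball x₀ 1, 0 ≤ φ x
  radial : ∀ x ∈ Metric.ball x₀ 1, φ x = Φ (dist x x₀)
  antitone : AntitoneOn Φ (Ico 0 1)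
  right_continuous : ∀ r ∈ Ico (0 : ℝ) 1, ContinuousWithinAt Φ (Ici r) r
  left_limits : ∀ r ∈ Ioo (0 : ℝ) 1, ∃ l : ℝ, Tendsto Φ (𝓝[<] r) (𝓝 l)
  nonzero : ∃ x ∈ Metric.ball x₀ 1 \ Metric.closedBall x₀ (1 / 2), φ x ≠ 0

/-- The mean of `u` over `E` with respect to the weight `φ`. -/
noncomputable def weightedMean {X : Type*} [MeasureSpace X] (φ : X → ℝ) (E : Set X)
    (u : X → ℝ) : ℝ :=
  (∫ x in E, u x * φ x) / ∫ x in E, φ x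

/-! By Jensen, the left side is at most the double integral of `|u x - u y| ^ p * φ x * φ y` divided
by the mass of `φ`. Since `φ x * φ y = max * min` and the maximum is at most `Φ 0`, it remains to
bound `A`, the same integral with weight `min (φ x) (φ y)`.

A radially decreasing weight is quasi-concave, so along a segment it stays above its minimum at the
endpoints. Cutting the segment into `N` equal jumps therefore bounds `A` by `N ^ (d + p)` times the
part of the integral with `|x - y| ≤ 2 / N` (`lintegral_lintegral_le_of_quasiconcave`).

Apply this at the scales `r_k = a / 2 ^ k`, with `a` comparable to `1 / R`, multiply by `r_k ^ (p *
(1 - s))` and sum over `k` (`lintegral_lintegral_le_fractional_energy`). On the right the truncated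
kernels add up to at most twice `|x - y| ^ (-(d + p * s))`. On the left the geometric series is at
least `a ^ q / q` with `q = p * (1 - s)`, which is the source of the factor `1 - s`. -/

/-! ### Dyadic sums of truncated kernels -/

/-- The sum of the terms below `t` of a sequence growing at least geometrically with ratio `2`
is at most `2 * t`. -/
theorem sum_ite_le_two_mul {b : ℕ → ℝ} (hb₀ : ∀ k, 0 ≤ b k) (hb : ∀ k, 2 * b k ≤ b (k + 1))
    {t : ℝ} (ht : 0 ≤ t) (n : ℕ) :
    ∑ k ∈ Finset.range n, (if b k ≤ t then b k else 0) ≤ 2 * t := by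
  have key : ∀ n, ∑ k ∈ Finset.range (n + 1), (if b k ≤ t then b k else 0) ≤ 2 * b n := by
    intro n
    induction n with
    | zero => simp only [zero_add, Finset.sum_range_one]; split_ifs <;> linarith [hb₀ 0]
    | succ n ih =>
      rw [Finset.sum_range_succ]
      have := hb n
      have := hb₀ (n + 1)
      split_ifs <;> linarith
  induction n with
  | zero => simpa using ht
  | succ n ih =>
    by_cases h : b n ≤ t
    · linarith [key n]
    · rw [Finset.sum_range_succ, if_neg h]; linarith

/-- As `D ≥ 1`, halving the scale at least doubles the term, so the smallest admissible scale
dominates. This rebuilds the singular kernel from truncations. -/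
theorem sum_ite_rpow_neg_le {D a r : ℝ} (hD : 1 ≤ D) (ha : 0 < a) (hr : 0 < r) (n : ℕ) :
    ∑ k ∈ Finset.range n, (if r ≤ a / 2 ^ k then (a / 2 ^ k) ^ (-D) else 0) ≤
      2 * (if r ≤ a then r ^ (-D) else 0) := by
  split_ifs with h
  · refine le_trans (Finset.sum_le_sum fun k _ => ?_)
      (sum_ite_le_two_mul (b := fun k : ℕ => (a / 2 ^ k) ^ (-D)) (fun k => by positivity)
        (fun k => ?_) (by positivity : 0 ≤ r ^ (-D)) n)
    · have h0 : (0 : ℝ) ≤ (a / 2 ^ k) ^ (-D) := by positivity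
      by_cases h1 : r ≤ a / 2 ^ k
      · have h2 : (a / 2 ^ k) ^ (-D) ≤ r ^ (-D) :=
          Real.rpow_le_rpow_of_nonpos hr h1 (by linarith)
        simp [h1, h2]
      · simp only [h1, if_false]
        split_ifs <;> simp [h0]
    · have h1 : a / 2 ^ (k + 1) = a / 2 ^ k * 2⁻¹ := by rw [pow_succ]; field_simp
      have h2 : (2 : ℝ) ≤ (2⁻¹ : ℝ) ^ (-D) := by
        rw [Real.inv_rpow (by norm_num), Real.rpow_neg (by norm_num), inv_inv]
        simpa using Real.rpow_le_rpow_of_exponent_le (by norm_num : (1 : ℝ) ≤ 2) hD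
      simp only [h1]
      rw [Real.mul_rpow (by positivity) (by positivity), mul_comm]
      gcongr
  · refine le_of_eq ?_
    rw [mul_zero]
    refine Finset.sum_eq_zero fun k _ => if_neg fun h' => h (h'.trans ?_)
    exact div_le_self ha.le (one_le_pow₀ (by norm_num))

/-! ### Telescoping along a segment -/

section Telescoping

variable {E : Type*} [AddCommGroup E] [Module ℝ E]

theorem enorm_sub_rpow_le_sum (v : E → ℝ) {p : ℝ} (hp : 1 ≤ p) (N : ℕ) (x h : E) :
    ‖v x - v (x + (N : ℝ) • h)‖ₑ ^ p ≤ (N : ENNReal) ^ (p - 1) *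
      ∑ i ∈ Finset.range N, ‖v (x + (i : ℝ) • h) - v (x + (i : ℝ) • h + h)‖ₑ ^ p := by
  have h1 : v x - v (x + (N : ℝ) • h) =
      ∑ i ∈ Finset.range N, (v (x + (i : ℝ) • h) - v (x + (i : ℝ) • h + h)) := by
    have := Finset.sum_range_sub' (fun i : ℕ => v (x + (i : ℝ) • h)) N
    simp only [Nat.cast_zero, zero_smul, add_zero] at this
    rw [← this]
    refine Finset.sum_congr rfl fun i _ => ?_
    rw [Nat.cast_succ, add_smul, one_smul, add_assoc]
  calc _ ≤ (∑ i ∈ Finset.range N, ‖v (x + (i : ℝ) • h) - v (x + (i : ℝ) • h + h)‖ₑ) ^ p := by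
        rw [h1]
        exact ENNReal.rpow_le_rpow (enorm_sum_le _ _) (by linarith)
    _ ≤ _ := by
        simpa using ENNReal.rpow_sum_le_const_mul_sum_rpow (Finset.range N)
          (fun i : ℕ => ‖v (x + (i : ℝ) • h) - v (x + (i : ℝ) • h + h)‖ₑ) hp

end Telescoping

/-! ### Chaining long jumps into short ones -/

section Chaining

variable {E : Type*} [NormedAddCommGroup E] [NormedSpace ℝ E] [MeasurableSpace E] [BorelSpace E]
  [FiniteDimensional ℝ E] (μ : Measure E) [μ.IsAddHaarMeasure]

theorem lintegral_comp_natCast_smul {f : E → ENNReal} (hf : Measurable f) {N : ℕ} (hN : 0 < N) :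
    ∫⁻ y, f y ∂μ = (N : ENNReal) ^ Module.finrank ℝ E * ∫⁻ h, f ((N : ℝ) • h) ∂μ := by
  have hN' : (N : ℝ) ≠ 0 := by positivity
  have h1 := lintegral_map (μ := μ) hf (measurable_const_smul (N : ℝ) : Measurable fun h : E => _)
  rw [Measure.map_addHaar_smul μ hN', lintegral_smul_measure] at h1
  rw [← h1, smul_eq_mul, ← mul_assoc, abs_of_nonneg (by positivity),
    ENNReal.ofReal_inv_of_pos (by positivity), ENNReal.ofReal_pow (by positivity),
    ENNReal.ofReal_natCast, ENNReal.mul_inv_cancel, one_mul]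
  · exact pow_ne_zero _ (by simpa using hN.ne')
  · exact ENNReal.pow_ne_top (by simp)

/-- Jumps of `v` of length at most `2`, weighted by a quasi-concave function, are controlled by
jumps of length at most `2 / N`. -/
theorem lintegral_lintegral_le_of_quasiconcave {v : E → ℝ} (hv : Measurable v) {w : E → ENNReal}
    (hw : Measurable w)
    (hwc : ∀ x y, ∀ t ∈ Icc (0 : ℝ) 1, min (w x) (w y) ≤ w (x + t • (y - x)))
    (hw0 : ∀ x, 1 ≤ ‖x‖ → w x = 0) {p : ℝ} (hp : 1 ≤ p) {N : ℕ} (hN : 0 < N) :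
    ∫⁻ x, ∫⁻ y, ‖v x - v y‖ₑ ^ p * min (w x) (w y) ∂μ ∂μ ≤
      (N : ENNReal) ^ ((Module.finrank ℝ E : ℝ) + p) *
        ∫⁻ x, ∫⁻ y, (if ‖x - y‖ ≤ 2 / N then 1 else 0) *
          (‖v x - v y‖ₑ ^ p * min (w x) (w y)) ∂μ ∂μ := by
  set d := Module.finrank ℝ E with hd
  set G : E → E → ENNReal := fun x y => ‖v x - v y‖ₑ ^ p * min (w x) (w y) with hG
  set H : E → E → ENNReal := fun x y => (if ‖x - y‖ ≤ 2 / N then 1 else 0) * G x y with hH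
  have hGm : Measurable (Function.uncurry G) := by
    simp only [hG, Function.uncurry_def]; fun_prop
  have hHm : Measurable (Function.uncurry H) := by
    have h1 : Measurable fun q : E × E => if ‖q.1 - q.2‖ ≤ 2 / N then (1 : ENNReal) else 0 :=
      Measurable.ite (measurableSet_le (by fun_prop) measurable_const)
        measurable_const measurable_const
    exact h1.mul hGm
  have hN0 : (0 : ℝ) < N := by exact_mod_cast hN
  have hpt : ∀ x h : E, G x (x + (N : ℝ) • h) ≤ (N : ENNReal) ^ (p - 1) *
      ∑ i ∈ Finset.range N, H (x + (i : ℝ) • h) (x + (i : ℝ) • h + h) := by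
    intro x h
    rcases eq_or_ne (min (w x) (w (x + (N : ℝ) • h))) 0 with h0 | h0
    · simp [hG, h0]
    have hx : ‖x‖ < 1 := by
      by_contra hx
      exact h0 (by simp [hw0 x (not_lt.1 hx)])
    have hy : ‖x + (N : ℝ) • h‖ < 1 := by
      by_contra hy
      exact h0 (by simp [hw0 _ (not_lt.1 hy)])
    -- Both endpoints lie in the unit ball, so `N • h` has length at most `2`.
    have hh : ‖h‖ ≤ 2 / N := by
      rw [le_div_iff₀ hN0]
      calc ‖h‖ * N = ‖(x + (N : ℝ) • h) - x‖ := by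
            rw [add_sub_cancel_left, norm_smul, Real.norm_natCast, mul_comm]
        _ ≤ ‖x + (N : ℝ) • h‖ + ‖x‖ := norm_sub_le _ _
        _ ≤ 2 := by linarith
    have hseg : ∀ i : ℕ, i ≤ N →
        min (w x) (w (x + (N : ℝ) • h)) ≤ w (x + (i : ℝ) • h) := by
      intro i hi
      have h1 := hwc x (x + (N : ℝ) • h) (i / N) ⟨by positivity, by
        rw [div_le_one hN0]; exact_mod_cast hi⟩
      rwa [add_sub_cancel_left, smul_smul, div_mul_cancel₀ _ hN0.ne'] at h1
    calc G x (x + (N : ℝ) • h) ≤ ((N : ENNReal) ^ (p - 1) *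
          ∑ i ∈ Finset.range N, ‖v (x + (i : ℝ) • h) - v (x + (i : ℝ) • h + h)‖ₑ ^ p) *
            min (w x) (w (x + (N : ℝ) • h)) := by
          simp only [hG]; gcongr; exact enorm_sub_rpow_le_sum v hp N x h
      _ ≤ _ := by
          rw [mul_assoc, Finset.sum_mul]
          gcongr with i hi
          have hi := Finset.mem_range.1 hi
          have h1 : ‖x + (i : ℝ) • h - (x + (i : ℝ) • h + h)‖ ≤ 2 / N := by
            simpa [sub_add_cancel_left] using hh
          simp only [hH, hG, h1, if_true, one_mul]
          refine mul_le_mul' le_rfl (le_min (hseg i hi.le) ?_)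
          have := hseg (i + 1) hi
          rwa [Nat.cast_succ, add_smul, one_smul, ← add_assoc] at this
  have hGh : Measurable (Function.uncurry fun x h : E => G x (x + (N : ℝ) • h)) :=
    hGm.comp (f := fun q : E × E => (q.1, q.1 + (N : ℝ) • q.2)) (by fun_prop)
  have hHh : ∀ c : ℝ, Measurable
      (Function.uncurry fun x h : E => H (x + c • h) (x + c • h + h)) := fun c =>
    hHm.comp (f := fun q : E × E => (q.1 + c • q.2, q.1 + c • q.2 + q.2)) (by fun_prop)
  calc ∫⁻ x, ∫⁻ y, G x y ∂μ ∂μ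
      = (N : ENNReal) ^ d * ∫⁻ x, ∫⁻ h, G x (x + (N : ℝ) • h) ∂μ ∂μ := by
        rw [← lintegral_const_mul' _ _ (ENNReal.pow_ne_top (by simp))]
        refine lintegral_congr fun x => ?_
        rw [← lintegral_add_left_eq_self (μ := μ) (fun y => G x y) x]
        exact lintegral_comp_natCast_smul μ (hGm.comp
          (f := fun y : E => (x, x + y)) (by fun_prop)) hN
    _ = (N : ENNReal) ^ d * ∫⁻ h, ∫⁻ x, G x (x + (N : ℝ) • h) ∂μ ∂μ := by
        rw [lintegral_lintegral_swap hGh.aemeasurable]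
    _ ≤ (N : ENNReal) ^ d * ∫⁻ h, ∫⁻ x, (N : ENNReal) ^ (p - 1) *
          ∑ i ∈ Finset.range N, H (x + (i : ℝ) • h) (x + (i : ℝ) • h + h) ∂μ ∂μ := by
        gcongr with h x
        exact hpt x h
    -- Translation invariance makes the `N` summands equal; the total exponent is `d + (p - 1) + 1`.
    _ = (N : ENNReal) ^ d * ∫⁻ h, (N : ENNReal) ^ (p - 1) *
          (N * ∫⁻ x, H x (x + h) ∂μ) ∂μ := by
        congr 1
        refine lintegral_congr fun h => ?_
        rw [lintegral_const_mul' _ _ (ENNReal.rpow_ne_top_of_nonneg (by linarith) (by simp)),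
          lintegral_finsetSum]
        · congr 1
          rw [Finset.sum_congr rfl fun (i : ℕ) _ =>
            lintegral_add_right_eq_self (μ := μ) (fun x => H x (x + h)) ((i : ℝ) • h)]
          simp
        · intro i _
          exact (hHh i).comp measurable_prodMk_right
    _ = (N : ENNReal) ^ ((d : ℝ) + p) * ∫⁻ h, ∫⁻ x, H x (x + h) ∂μ ∂μ := by
        have hN1 : (N : ENNReal) ≠ 0 := by simpa using hN.ne'
        rw [lintegral_const_mul' _ _ (ENNReal.rpow_ne_top_of_nonneg (by linarith) (by simp)),
          lintegral_const_mul' _ _ (by simp), ← mul_assoc, ← mul_assoc]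
        congr 1
        rw [← ENNReal.rpow_natCast, ← ENNReal.rpow_add _ _ hN1 (by simp)]
        nth_rw 2 [← ENNReal.rpow_one (N : ENNReal)]
        rw [← ENNReal.rpow_add _ _ hN1 (by simp)]
        congr 1; ring
    _ = (N : ENNReal) ^ ((d : ℝ) + p) * ∫⁻ x, ∫⁻ y, H x y ∂μ ∂μ := by
        have hH0 : Measurable (Function.uncurry fun h x : E => H x (x + h)) :=
          hHm.comp (f := fun q : E × E => (q.2, q.2 + q.1)) (by fun_prop)
        rw [lintegral_lintegral_swap hH0.aemeasurable]
        congr 1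
        refine lintegral_congr fun x => ?_
        exact lintegral_add_left_eq_self (μ := μ) (fun y => H x y) x

end Chaining

/-! ### Jensen's inequality and a geometric series -/

/-- Jensen for the normalized measure, applied to `y ↦ v x - v y` for each `x`. -/
theorem lintegral_enorm_sub_average_rpow_le {α : Type*} [MeasurableSpace α] {ν : Measure α}
    [IsFiniteMeasure ν] [NeZero ν] {v : α → ℝ} (hv : Integrable v ν) {p : ℝ} (hp : 1 ≤ p) :
    ∫⁻ x, ‖v x - ⨍ y, v y ∂ν‖ₑ ^ p ∂ν ≤
      (ν univ)⁻¹ * ∫⁻ x, ∫⁻ y, ‖v x - v y‖ₑ ^ p ∂ν ∂ν := by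
  have hc : (ν univ)⁻¹ ≠ ⊤ := by simp [NeZero.ne ν]
  rw [← lintegral_const_mul' _ _ hc]
  refine lintegral_mono fun x => ?_
  have hP : IsProbabilityMeasure ((ν univ)⁻¹ • ν) := inferInstance
  have hv' : Integrable v ((ν univ)⁻¹ • ν) := hv.smul_measure hc
  rw [average_eq', ← smul_eq_mul, ← lintegral_smul_measure]
  generalize (ν univ)⁻¹ • ν = P at hP hv'
  have h1 : v x - ∫ y, v y ∂P = ∫ y, (v x - v y) ∂P := by
    rw [integral_sub (integrable_const _) hv']; simp
  have h2 := eLpNorm'_le_eLpNorm'_of_exponent_le (f := fun y => v x - v y) one_pos hp P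
    ((integrable_const _).sub hv').aestronglyMeasurable
  have h3 : ‖v x - ∫ y, v y ∂P‖ₑ ≤ eLpNorm' (fun y => v x - v y) p P := by
    refine le_trans ?_ h2
    rw [h1]
    simpa [eLpNorm'] using enorm_integral_le_lintegral_enorm (μ := P) fun y => v x - v y
  calc _ ≤ eLpNorm' (fun y => v x - v y) p P ^ p :=
        ENNReal.rpow_le_rpow h3 (by linarith)
    _ = _ := (lintegral_rpow_enorm_eq_rpow_eLpNorm' (by linarith)).symm

/-- The series equals `a ^ q / (1 - 2 ^ (-q))`, and `1 - 2 ^ (-q) ≤ q * log 2 ≤ q`. -/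
theorem ofReal_inv_le_tsum_rpow {a q : ℝ} (ha : 0 < a) (hq : 0 < q) :
    ENNReal.ofReal (a ^ q / q) ≤ ∑' k : ℕ, ENNReal.ofReal ((a / 2 ^ k) ^ q) := by
  have h1 : ∀ k : ℕ, ENNReal.ofReal ((a / 2 ^ k) ^ q) =
      ENNReal.ofReal (a ^ q) * ENNReal.ofReal (2 ^ (-q)) ^ k := by
    intro k
    rw [← ENNReal.ofReal_pow (by positivity), ← ENNReal.ofReal_mul (by positivity),
      Real.div_rpow ha.le (by positivity), Real.rpow_neg (by norm_num), inv_pow, div_eq_mul_inv,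
      ← Real.rpow_natCast_mul (by norm_num), ← Real.rpow_mul_natCast (by norm_num), mul_comm q]
  simp only [h1]
  rw [ENNReal.tsum_mul_left, ENNReal.tsum_geometric, div_eq_mul_inv,
    ENNReal.ofReal_mul (by positivity), ENNReal.ofReal_inv_of_pos hq]
  gcongr
  rw [tsub_le_iff_right, ← ENNReal.ofReal_add hq.le (by positivity), ← ENNReal.ofReal_one]
  apply ENNReal.ofReal_le_ofReal
  have h2 := Real.add_one_le_exp (Real.log 2 * -q)
  rw [Real.rpow_def_of_pos (by norm_num)]
  nlinarith [Real.log_two_lt_d9]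

/-! ### Summation over scales -/

section Energy

variable {E : Type*} [NormedAddCommGroup E] [NormedSpace ℝ E] [MeasurableSpace E] [BorelSpace E]
  [FiniteDimensional ℝ E] (μ : Measure E) [μ.IsAddHaarMeasure]

theorem lintegral_lintegral_le_fractional_energy (hd : 1 ≤ Module.finrank ℝ E) {v : E → ℝ}
    (hv : Measurable v) {w : E → ENNReal} (hw : Measurable w)
    (hwc : ∀ x y, ∀ t ∈ Icc (0 : ℝ) 1, min (w x) (w y) ≤ w (x + t • (y - x)))
    (hw0 : ∀ x, 1 ≤ ‖x‖ → w x = 0) {p : ℝ} (hp : 1 ≤ p) {R : ℝ} (hR : 1 ≤ R) {s : ℝ}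
    (hs₀ : 0 ≤ s) (hs : s < 1) :
    ∫⁻ x, ∫⁻ y, ‖v x - v y‖ₑ ^ p * min (w x) (w y) ∂μ ∂μ ≤
      ENNReal.ofReal (2 ^ ((Module.finrank ℝ E : ℝ) + 2 * p + 1) * p * (1 - s) *
        R ^ (p * (1 - s))) *
        ∫⁻ x, ∫⁻ y, ENNReal.ofReal
          (if ‖x - y‖ ≤ 1 / R then ‖x - y‖ ^ (-((Module.finrank ℝ E : ℝ) + p * s)) else 0) *
          (‖v x - v y‖ₑ ^ p * min (w x) (w y)) ∂μ ∂μ := by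
  set d : ℝ := (Module.finrank ℝ E : ℝ) with hd_def
  have hd1 : 1 ≤ d := by rw [hd_def]; exact_mod_cast hd
  set q : ℝ := p * (1 - s) with hq_def
  have hq : 0 < q := mul_pos (by linarith) (by linarith)
  have hqp : q ≤ p := by nlinarith
  set D : ℝ := d + p * s with hD_def
  have hD : 1 ≤ D := by nlinarith
  set G : E → E → ENNReal := fun x y => ‖v x - v y‖ₑ ^ p * min (w x) (w y) with hG
  have hGm : Measurable (Function.uncurry G) := by
    simp only [hG, Function.uncurry_def]; fun_prop
  -- This places `a = 2 / M` in `[1 / (2 * R), 1 / R]`.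
  obtain ⟨M, hM2, hM3⟩ : ∃ M : ℕ, 2 * R ≤ M ∧ (M : ℝ) ≤ 4 * R :=
    ⟨⌈2 * R⌉₊, Nat.le_ceil _, by linarith [Nat.ceil_lt_add_one (by linarith : 0 ≤ 2 * R)]⟩
  have hM0 : (0 : ℝ) < M := by linarith
  set a : ℝ := 2 / M with ha_def
  have ha : 0 < a := by positivity
  have haR : a ≤ 1 / R := by
    rw [ha_def, div_le_div_iff₀ hM0 (by linarith)]; linarith
  set A := ∫⁻ x, ∫⁻ y, G x y ∂μ ∂μ with hA
  set T := ∫⁻ x, ∫⁻ y, ENNReal.ofReal (if ‖x - y‖ ≤ 1 / R then ‖x - y‖ ^ (-D) else 0) *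
    G x y ∂μ ∂μ with hT
  have hcut : ∀ c : ℝ, Measurable fun z : E × E =>
      (if ‖z.1 - z.2‖ ≤ c then (1 : ENNReal) else 0) * G z.1 z.2 := fun c =>
    (Measurable.ite (measurableSet_le (by fun_prop) measurable_const)
      measurable_const measurable_const).mul hGm
  -- Chaining with `N = M * 2 ^ k = 2 / r_k`, multiplied by `r_k ^ q`; the exponents match because
  -- `q - (d + p) = -D`.
  have hscale : ∀ k : ℕ, ENNReal.ofReal ((a / 2 ^ k) ^ q) * A ≤ ENNReal.ofReal (2 ^ (d + p)) *
      ∫⁻ x, ∫⁻ y, ENNReal.ofReal ((a / 2 ^ k) ^ (-D)) *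
        ((if ‖x - y‖ ≤ a / 2 ^ k then 1 else 0) * G x y) ∂μ ∂μ := by
    intro k
    have hN : 0 < M * 2 ^ k := by
      have : 0 < M := by exact_mod_cast hM0
      positivity
    have h1 := lintegral_lintegral_le_of_quasiconcave μ hv hw hwc hw0 hp hN
    have h2 : (2 : ℝ) / ((M * 2 ^ k : ℕ) : ℝ) = a / 2 ^ k := by
      rw [ha_def]; push_cast; rw [div_div]
    have h3 : ((M * 2 ^ k : ℕ) : ENNReal) = ENNReal.ofReal (2 / (a / 2 ^ k)) := by
      rw [← h2, div_div_cancel₀ (by norm_num), ENNReal.ofReal_natCast]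
    rw [h2, h3, ENNReal.ofReal_rpow_of_pos (by positivity)] at h1
    simp only [lintegral_const_mul' _ _ ENNReal.ofReal_ne_top]
    refine (mul_le_mul' le_rfl h1).trans (le_of_eq ?_)
    rw [← mul_assoc, ← mul_assoc, ← ENNReal.ofReal_mul (by positivity),
      ← ENNReal.ofReal_mul (by positivity), Real.div_rpow (x := 2) (y := a / 2 ^ k) (by norm_num) (by positivity)]
    congr 2
    have h4 : (a / 2 ^ k) ^ (-D) = (a / 2 ^ k) ^ q / (a / 2 ^ k) ^ (d + p) := by
      rw [← Real.rpow_sub (by positivity)]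
      congr 1; rw [hD_def, hq_def]; ring
    rw [h4, hd_def]; ring
  have hsum : ∀ n : ℕ, ∑ k ∈ Finset.range n, ∫⁻ x, ∫⁻ y, ENNReal.ofReal ((a / 2 ^ k) ^ (-D)) *
      ((if ‖x - y‖ ≤ a / 2 ^ k then 1 else 0) * G x y) ∂μ ∂μ ≤ 2 * T := by
    intro n
    have hm : ∀ k : ℕ, Measurable fun z : E × E => ENNReal.ofReal ((a / 2 ^ k) ^ (-D)) *
        ((if ‖z.1 - z.2‖ ≤ a / 2 ^ k then 1 else 0) * G z.1 z.2) := fun k =>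
      (hcut _).const_mul _
    rw [← lintegral_finsetSum _ fun k _ => (hm k).lintegral_prod_right', hT,
      ← lintegral_const_mul' _ _ (by simp)]
    refine lintegral_mono fun x => ?_
    have hmx : ∀ k : ℕ, Measurable fun y : E => ENNReal.ofReal ((a / 2 ^ k) ^ (-D)) *
        ((if ‖x - y‖ ≤ a / 2 ^ k then 1 else 0) * G x y) := fun k =>
      (hm k).comp (measurable_prodMk_left (x := x))
    dsimp only
    rw [← lintegral_finsetSum _ fun k _ => hmx k, ← lintegral_const_mul' _ _ (by simp)]
    refine lintegral_mono fun y => ?_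
    -- On the diagonal `0 ^ (-D) = 0` in Lean, so the kernel bound is replaced by `G x x = 0`.
    rcases eq_or_ne x y with rfl | hxy
    · have : G x x = 0 := by simp [hG, show 0 < p by linarith]
      simp [this]
    have hr : 0 < ‖x - y‖ := norm_pos_iff.2 (sub_ne_zero.2 hxy)
    simp only [← mul_assoc, ← Finset.sum_mul]
    gcongr
    have h1 := sum_ite_rpow_neg_le hD ha hr n
    have h2 : (if ‖x - y‖ ≤ a then ‖x - y‖ ^ (-D) else 0) ≤
        (if ‖x - y‖ ≤ 1 / R then ‖x - y‖ ^ (-D) else 0) := by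
      by_cases h : ‖x - y‖ ≤ a
      · rw [if_pos h, if_pos (h.trans haR)]
      · rw [if_neg h]; positivity
    have h3 := ENNReal.ofReal_le_ofReal (h1.trans (mul_le_mul_of_nonneg_left h2 zero_le_two))
    rw [ENNReal.ofReal_sum_of_nonneg (fun k _ => by positivity),
      ENNReal.ofReal_mul zero_le_two, ENNReal.ofReal_ofNat] at h3
    refine le_trans (le_of_eq (Finset.sum_congr rfl fun k _ => ?_)) h3
    split_ifs <;> simp
  have htot : (∑' k : ℕ, ENNReal.ofReal ((a / 2 ^ k) ^ q)) * A ≤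
      ENNReal.ofReal (2 ^ (d + p)) * (2 * T) := by
    rw [← ENNReal.tsum_mul_right]
    refine ENNReal.tsum_le_of_sum_range_le fun n => ?_
    refine (Finset.sum_le_sum fun k _ => hscale k).trans ?_
    rw [← Finset.mul_sum]
    gcongr
    exact hsum n
  have hc : 0 < a ^ q / q := by positivity
  have hmain : ENNReal.ofReal (a ^ q / q) * A ≤ ENNReal.ofReal (2 ^ (d + p)) * (2 * T) :=
    (mul_le_mul' (ofReal_inv_le_tsum_rpow ha hq) le_rfl).trans htot
  -- Besides the chaining factor `2 ^ (d + p)` and the kernel factor `2`, a factor `2 ^ p` comes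
  -- from `a⁻¹ ≤ 2 * R` and `q ≤ p`.
  have hfin : (a ^ q / q)⁻¹ * (2 ^ (d + p) * 2) ≤ 2 ^ (d + 2 * p + 1) * p * (1 - s) * R ^ q := by
    have h1 : (a ^ q)⁻¹ ≤ 2 ^ p * R ^ q := by
      rw [← Real.inv_rpow ha.le]
      calc (a⁻¹) ^ q ≤ (2 * R) ^ q := by
            gcongr
            rw [ha_def, inv_div]; linarith
        _ = 2 ^ q * R ^ q := Real.mul_rpow (by norm_num) (by linarith)
        _ ≤ 2 ^ p * R ^ q := by
            gcongr
            norm_num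
    have h2 : (2 : ℝ) ^ (d + 2 * p + 1) = 2 ^ p * (2 ^ (d + p) * 2) := by
      nth_rw 5 [← Real.rpow_one 2]
      rw [← Real.rpow_add (by norm_num), ← Real.rpow_add (by norm_num)]
      congr 1; ring
    rw [h2, inv_div, div_eq_mul_inv]
    calc q * (a ^ q)⁻¹ * (2 ^ (d + p) * 2) ≤ q * (2 ^ p * R ^ q) * (2 ^ (d + p) * 2) := by gcongr
      _ = _ := by rw [hq_def]; ring
  calc A = ENNReal.ofReal (a ^ q / q)⁻¹ * (ENNReal.ofReal (a ^ q / q) * A) := by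
        rw [← mul_assoc, ← ENNReal.ofReal_mul (by positivity), inv_mul_cancel₀ hc.ne']; simp
    _ ≤ ENNReal.ofReal (a ^ q / q)⁻¹ * (ENNReal.ofReal (2 ^ (d + p)) * (2 * T)) := by gcongr
    _ = ENNReal.ofReal ((a ^ q / q)⁻¹ * (2 ^ (d + p) * 2)) * T := by
        rw [ENNReal.ofReal_mul (by positivity), ENNReal.ofReal_mul (by positivity)]
        simp only [ENNReal.ofReal_ofNat, mul_assoc]
    _ ≤ _ := by gcongr

end Energy

/-! ### The weighted inequality on the whole space -/

/-- The antitone extension of a profile on `[0, 1)` to the real line, vanishing on `[1, ∞)`. -/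
noncomputable def profileExtension (Φ : ℝ → ℝ) (r : ℝ) : NNReal :=
  if r < 1 then (Φ (max r 0)).toNNReal else 0

theorem profileExtension_antitone {Φ : ℝ → ℝ} (hΦ : AntitoneOn Φ (Ico 0 1)) :
    Antitone (profileExtension Φ) := by
  intro a b hab
  unfold profileExtension
  split_ifs with hb ha
  · exact Real.toNNReal_le_toNNReal (hΦ ⟨le_max_right _ _, max_lt ha one_pos⟩
      ⟨le_max_right _ _, max_lt hb one_pos⟩ (max_le_max_right 0 hab))
  · linarith
  · exact zero_le
  · exact le_rfl

theorem lintegral_eq_setLIntegral_of_forall_notMem {α : Type*} [MeasurableSpace α]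
    {μ : Measure α} {B : Set α} (hB : MeasurableSet B) {f : α → ENNReal}
    (hf : ∀ x ∉ B, f x = 0) : ∫⁻ x, f x ∂μ = ∫⁻ x in B, f x ∂μ := by
  rw [← lintegral_indicator hB]
  congr 1
  exact (indicator_eq_self.2 fun x hx => by_contra fun h => hx (hf x h)).symm

section WeightedPoincare

variable {E : Type*} [NormedAddCommGroup E] [NormedSpace ℝ E] [MeasurableSpace E] [BorelSpace E]
  [FiniteDimensional ℝ E] (μ : Measure E) [μ.IsAddHaarMeasure]

/-- Weighted fractional Poincaré inequality for a bounded radially decreasing weight. -/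
theorem lintegral_enorm_sub_average_le_fractional_energy (hd : 1 ≤ Module.finrank ℝ E)
    {g : ℝ → NNReal} (hg : Antitone g) (hg1 : ∀ r, 1 ≤ r → g r = 0)
    (ν : Measure E) (hν : ν = μ.withDensity fun x => (g ‖x‖ : ENNReal))
    [IsFiniteMeasure ν] [NeZero ν] {v : E → ℝ}
    (hv : Measurable v) (hvi : Integrable v ν) {p : ℝ} (hp : 1 ≤ p) {R : ℝ} (hR : 1 ≤ R) {s : ℝ}
    (hs₀ : 0 ≤ s) (hs : s < 1) :
    ∫⁻ x, (g ‖x‖ : ENNReal) * ‖v x - ⨍ y, v y ∂ν‖ₑ ^ p ∂μ ≤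
      (ν univ)⁻¹ * g 0 * (ENNReal.ofReal (2 ^ ((Module.finrank ℝ E : ℝ) + 2 * p + 1) * p *
        (1 - s) * R ^ (p * (1 - s))) *
        ∫⁻ x, ∫⁻ y, ENNReal.ofReal
          (if ‖x - y‖ ≤ 1 / R then ‖x - y‖ ^ (-((Module.finrank ℝ E : ℝ) + p * s)) else 0) *
          (‖v x - v y‖ₑ ^ p * min (g ‖x‖ : ENNReal) (g ‖y‖)) ∂μ ∂μ) := by
  have hw : Measurable fun x : E => (g ‖x‖ : ENNReal) :=
    (hg.measurable.comp measurable_norm).coe_nnreal_ennreal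
  -- Quasi-concavity: the norm is convex and `g` is antitone.
  have hwc : ∀ x y : E, ∀ t ∈ Icc (0 : ℝ) 1,
      min (g ‖x‖ : ENNReal) (g ‖y‖) ≤ g ‖x + t • (y - x)‖ := by
    intro x y t ht
    rw [← ENNReal.coe_min, ENNReal.coe_le_coe, ← hg.map_max]
    refine hg ?_
    exact ((convexOn_norm convex_univ).le_max_of_mem_segment (mem_univ x) (mem_univ y)
      (by rw [segment_eq_image']; exact ⟨t, ht, rfl⟩))
  have hden : ∀ f : E → ENNReal, Measurable f → ∫⁻ x, f x ∂ν = ∫⁻ x, g ‖x‖ * f x ∂μ := by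
    intro f hf
    rw [hν, lintegral_withDensity_eq_lintegral_mul _ hw hf]; rfl
  have hpow : Measurable fun z : E × E => ‖v z.1 - v z.2‖ₑ ^ p := by fun_prop
  have hinner : Measurable fun x => ∫⁻ y, ‖v x - v y‖ₑ ^ p ∂ν := hpow.lintegral_prod_right'
  calc ∫⁻ x, (g ‖x‖ : ENNReal) * ‖v x - ⨍ y, v y ∂ν‖ₑ ^ p ∂μ
      = ∫⁻ x, ‖v x - ⨍ y, v y ∂ν‖ₑ ^ p ∂ν := (hden _ (by fun_prop)).symm
    _ ≤ (ν univ)⁻¹ * ∫⁻ x, ∫⁻ y, ‖v x - v y‖ₑ ^ p ∂ν ∂ν :=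
        lintegral_enorm_sub_average_rpow_le hvi hp
    _ ≤ (ν univ)⁻¹ * (g 0 *
          ∫⁻ x, ∫⁻ y, ‖v x - v y‖ₑ ^ p * min (g ‖x‖ : ENNReal) (g ‖y‖) ∂μ ∂μ) := by
        gcongr
        rw [hden _ hinner, ← lintegral_const_mul' _ _ ENNReal.coe_ne_top]
        refine lintegral_mono fun x => ?_
        rw [hden _ (by fun_prop), ← lintegral_const_mul' _ _ ENNReal.coe_ne_top,
          ← lintegral_const_mul' _ _ ENNReal.coe_ne_top]
        refine lintegral_mono fun y => ?_
        have hmm : (g ‖x‖ : ENNReal) * g ‖y‖ ≤ g 0 * min (g ‖x‖ : ENNReal) (g ‖y‖) := by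
          rw [← max_mul_min]
          gcongr
          exact max_le (by exact_mod_cast hg (norm_nonneg x)) (by exact_mod_cast hg (norm_nonneg y))
        dsimp only
        rw [← mul_assoc, mul_comm (‖v x - v y‖ₑ ^ p), ← mul_assoc]
        gcongr
    _ ≤ _ := by
        rw [mul_assoc]
        gcongr
        exact lintegral_lintegral_le_fractional_energy μ hd hv hw hwc
          (fun x hx => by simp [hg1 _ hx]) hp hR hs₀ hs

end WeightedPoincare

/-! ### Reduction of the statement on the ball -/

theorem corollary3p4 (d : ℕ) (p : ℝ) (hp : 1 ≤ p) (s₀ : ℝ) (hs₀ : 0 < s₀) (Φ : ℝ → ℝ) :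
    ∃ C : ℝ, 0 < C ∧
      ∀ φ : EuclideanSpace ℝ (Fin d) → ℝ, IsRadiallyDecreasingWeight 0 φ Φ →
      ∀ R : ℝ, 1 ≤ R → ∀ s : ℝ, s₀ ≤ s → s < 1 →
      ∀ u : EuclideanSpace ℝ (Fin d) → ℝ,
        MemLp u (ENNReal.ofReal p) (volume.restrict (Metric.ball 0 1)) →
        ∫⁻ x in Metric.ball (0 : EuclideanSpace ℝ (Fin d)) 1,
            ENNReal.ofReal (|u x - weightedMean φ (Metric.ball 0 1) u| ^ p * φ x)
          ≤ ENNReal.ofReal (C * (1 - s) * R ^ (p * (1 - s))) *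
            ∫⁻ x in Metric.ball (0 : EuclideanSpace ℝ (Fin d)) 1,
              ∫⁻ y in Metric.ball (0 : EuclideanSpace ℝ (Fin d)) 1,
                ENNReal.ofReal (|u x - u y| ^ p / ‖x - y‖ ^ ((d : ℝ) + p * s) *
                  (if ‖x - y‖ ≤ 1 / R then 1 else 0) * min (φ y) (φ x)) := by
  -- `C` is chosen before `φ`; any one weight with profile `Φ` supplies the properties of `Φ` needed
  -- for this.
  by_cases hex : ∃ φ : EuclideanSpace ℝ (Fin d) → ℝ, IsRadiallyDecreasingWeight 0 φ Φ
  swap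
  · exact ⟨1, one_pos, fun φ hφ => (hex ⟨φ, hφ⟩).elim⟩
  obtain ⟨φ₀, hφ₀⟩ := hex
  set B : Set (EuclideanSpace ℝ (Fin d)) := Metric.ball 0 1 with hB_def
  have hBm : MeasurableSet B := measurableSet_ball
  have hmem : ∀ x : EuclideanSpace ℝ (Fin d), x ∈ B ↔ ‖x‖ < 1 := fun x => by
    simp [hB_def]
  have hBfin : IsFiniteMeasure (volume.restrict B) :=
    ⟨by simpa using measure_ball_lt_top⟩
  set g := profileExtension Φ with hg_def
  have hg : Antitone g := profileExtension_antitone hφ₀.antitone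
  have hg1 : ∀ r, 1 ≤ r → g r = 0 := fun r hr => if_neg hr.not_gt
  have hwm : Measurable fun x : EuclideanSpace ℝ (Fin d) => g ‖x‖ :=
    hg.measurable.comp measurable_norm
  have hout : ∀ x ∉ B, g ‖x‖ = 0 := fun x hx => hg1 _ (not_lt.1 fun h => hx ((hmem x).2 h))
  have hgφ : ∀ φ : EuclideanSpace ℝ (Fin d) → ℝ, IsRadiallyDecreasingWeight 0 φ Φ →
      ∀ x ∈ B, φ x = g ‖x‖ := by
    intro φ hφ x hx
    have h0 := hφ.nonneg x hx
    have h1 := hφ.radial x hx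
    rw [dist_zero_right] at h1
    simp only [hg_def, profileExtension]
    rw [if_pos ((hmem x).1 hx), max_eq_left (norm_nonneg x), ← h1, Real.coe_toNNReal _ h0]
  set ν : Measure (EuclideanSpace ℝ (Fin d)) :=
    volume.withDensity fun x => (g ‖x‖ : ENNReal) with hν
  have hνu : ν univ = ∫⁻ x in B, (g ‖x‖ : ENNReal) := by
    rw [hν, withDensity_apply _ MeasurableSet.univ, Measure.restrict_univ,
      lintegral_eq_setLIntegral_of_forall_notMem hBm fun x hx => by simp [hout x hx]]
  have hνfin : IsFiniteMeasure ν := by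
    refine ⟨?_⟩
    rw [hνu]
    calc ∫⁻ x in B, (g ‖x‖ : ENNReal) ≤ ∫⁻ x in B, (g 0 : ENNReal) :=
          lintegral_mono fun x => ENNReal.coe_le_coe.2 (hg (norm_nonneg x))
      _ < ⊤ := by
          rw [setLIntegral_const]
          exact ENNReal.mul_lt_top ENNReal.coe_lt_top measure_ball_lt_top
  obtain ⟨x₁, ⟨hx₁, hx₁'⟩, hφx₁⟩ := hφ₀.nonzero
  have hx₁2 : 1 / 2 < ‖x₁‖ := by simpa using hx₁'
  have hgx₁ : 0 < g ‖x₁‖ := by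
    rw [pos_iff_ne_zero]
    intro h
    exact hφx₁ (by rw [hgφ φ₀ hφ₀ x₁ hx₁, h]; rfl)
  -- In dimension `0` the annulus containing `x₁` would be empty.
  have hd : 1 ≤ d := by
    rcases Nat.eq_zero_or_pos d with rfl | h
    · rw [Subsingleton.elim x₁ 0, norm_zero] at hx₁2
      norm_num at hx₁2
    · exact h
  -- Monotonicity gives `g ≥ g ‖x₁‖ > 0` on the half ball, because `‖x₁‖ > 1 / 2`.
  have hνpos : 0 < ν univ := by
    rw [hνu]
    calc (0 : ENNReal) < g ‖x₁‖ * volume (Metric.ball (0 : EuclideanSpace ℝ (Fin d)) (1 / 2)) :=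
          ENNReal.mul_pos (by simpa using hgx₁.ne')
            (Metric.measure_ball_pos _ _ (by norm_num)).ne'
      _ = ∫⁻ x in Metric.ball (0 : EuclideanSpace ℝ (Fin d)) (1 / 2), (g ‖x₁‖ : ENNReal) :=
          (setLIntegral_const _ _).symm
      _ ≤ ∫⁻ x in Metric.ball (0 : EuclideanSpace ℝ (Fin d)) (1 / 2), (g ‖x‖ : ENNReal) := by
          refine setLIntegral_mono' measurableSet_ball fun x hx => ?_
          have : ‖x‖ < 1 / 2 := by simpa using hx
          exact_mod_cast hg (by linarith)
      _ ≤ ∫⁻ x in B, (g ‖x‖ : ENNReal) :=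
          lintegral_mono_set (Metric.ball_subset_ball (by norm_num))
  have hν0 : NeZero ν := ⟨fun h => by simp [h] at hνpos⟩
  have hg0 : 0 < g 0 := hgx₁.trans_le (hg (norm_nonneg _))
  have hνr : 0 < (ν univ).toReal := ENNReal.toReal_pos hνpos.ne' (measure_ne_top _ _)
  refine ⟨(ν univ).toReal⁻¹ * g 0 * (2 ^ ((d : ℝ) + 2 * p + 1) * p), by positivity, ?_⟩
  intro φ hφ R hR s hs hs1 u hu
  have hφg := hgφ φ hφ
  -- A measurable representative `v` is needed globally; it agrees with `u` only almost everywhere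
  -- on `B`, and `ν` has no mass elsewhere.
  obtain ⟨v, hvm, huv⟩ := hu.aestronglyMeasurable
  have hvm := hvm.measurable
  have hv : MemLp v (ENNReal.ofReal p) (volume.restrict B) := hu.ae_eq huv
  have hvB : IntegrableOn v B := hv.integrable (by simpa using hp)
  have hvi : Integrable v ν := by
    rw [hν, integrable_withDensity_iff_integrable_smul hwm]
    refine IntegrableOn.integrable_of_forall_notMem_eq_zero (s := B) ?_
      fun x hx => by simp [hout x hx]
    refine Integrable.bdd_mul (c := (g 0 : ℝ)) hvB
      (hwm.coe_nnreal_real.aestronglyMeasurable) (Eventually.of_forall fun x => ?_)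
    simpa using hg (norm_nonneg x)
  have hmean : weightedMean φ B u = ⨍ y, v y ∂ν := by
    have hint : ∀ f : EuclideanSpace ℝ (Fin d) → ℝ,
        ∫ x, f x ∂ν = ∫ x in B, f x * g ‖x‖ := by
      intro f
      rw [hν, integral_withDensity_eq_integral_smul hwm,
        ← setIntegral_eq_integral_of_forall_compl_eq_zero (s := B)
          fun x hx => by simp [hout x hx]]
      refine integral_congr_ae (Eventually.of_forall fun x => ?_)
      simp [NNReal.smul_def, mul_comm]
    have h1 : ∫ x in B, u x * φ x = ∫ x, v x ∂ν := by
      rw [hint]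
      refine integral_congr_ae ?_
      filter_upwards [huv, ae_restrict_mem hBm] with x hx hxB
      rw [hx, hφg x hxB]
    have h2 : ∫ x in B, φ x = ν.real univ := by
      have := hint fun _ => 1
      simp only [one_mul, integral_const, smul_eq_mul, mul_one] at this
      rw [this]
      exact setIntegral_congr_fun hBm hφg
    rw [weightedMean, h1, h2, average_eq, smul_eq_mul, div_eq_inv_mul]
  have hmain := lintegral_enorm_sub_average_le_fractional_energy volume
    (by simpa using hd) hg hg1 ν hν hvm hvi hp hR (hs₀.le.trans hs) hs1
  rw [finrank_euclideanSpace_fin] at hmain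
  have hlhs : ∫⁻ x in B, ENNReal.ofReal (|u x - weightedMean φ B u| ^ p * φ x) =
      ∫⁻ x, (g ‖x‖ : ENNReal) * ‖v x - ⨍ y, v y ∂ν‖ₑ ^ p := by
    rw [lintegral_eq_setLIntegral_of_forall_notMem (μ := volume) hBm fun x hx => by simp [hout x hx], hmean]
    refine lintegral_congr_ae ?_
    filter_upwards [huv, ae_restrict_mem hBm] with x hx hxB
    rw [hx, hφg x hxB, ENNReal.ofReal_mul (by positivity), ENNReal.ofReal_coe_nnreal, mul_comm,
      ← ENNReal.ofReal_rpow_of_nonneg (abs_nonneg _) (by linarith), ← Real.enorm_eq_ofReal_abs]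
  have hrhs : ∫⁻ x in B, ∫⁻ y in B, ENNReal.ofReal (|u x - u y| ^ p /
        ‖x - y‖ ^ ((d : ℝ) + p * s) * (if ‖x - y‖ ≤ 1 / R then 1 else 0) * min (φ y) (φ x)) =
      ∫⁻ x, ∫⁻ y, ENNReal.ofReal
          (if ‖x - y‖ ≤ 1 / R then ‖x - y‖ ^ (-((d : ℝ) + p * s)) else 0) *
          (‖v x - v y‖ₑ ^ p * min (g ‖x‖ : ENNReal) (g ‖y‖)) := by
    rw [lintegral_eq_setLIntegral_of_forall_notMem (μ := volume) hBm fun x hx => by simp [hout x hx]]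
    refine lintegral_congr_ae ?_
    filter_upwards [huv, ae_restrict_mem hBm] with x hx hxB
    rw [lintegral_eq_setLIntegral_of_forall_notMem (μ := volume) hBm fun y hy => by simp [hout y hy]]
    refine lintegral_congr_ae ?_
    filter_upwards [huv, ae_restrict_mem hBm] with y hy hyB
    rw [hx, hy, hφg x hxB, hφg y hyB, Real.enorm_eq_ofReal_abs,
      ENNReal.ofReal_rpow_of_nonneg (abs_nonneg _) (by linarith), ← ENNReal.coe_min,
      ← ENNReal.ofReal_coe_nnreal, ← ENNReal.ofReal_mul (by positivity),
      ← ENNReal.ofReal_mul (by positivity), NNReal.coe_min, min_comm,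
      Real.rpow_neg (norm_nonneg _)]
    congr 1
    split_ifs
    · ring
    · simp
  rw [hlhs, hrhs]
  refine hmain.trans (le_of_eq ?_)
  rw [← mul_assoc]
  congr 1
  rw [← ENNReal.ofReal_coe_nnreal, ← ENNReal.ofReal_toReal (measure_ne_top ν univ),
    ← ENNReal.ofReal_inv_of_pos hνr, ← ENNReal.ofReal_mul (by positivity),
    ← ENNReal.ofReal_mul (by positivity), ENNReal.toReal_ofReal hνr.le]
  congr 1
  ring
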